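/- For every $d\in\mathbb N$ let $A=A_d\in\mathbb R^{d\times d}$ be symmetric positive definite with spectral decomposition $A=Q\,\mathrm{diag}(\lambda_1^2,\dots,\lambda_d^2)\,Q^T$, where $Q$ is orthogonal and $\lambda_i>0$, and let $b,\beta\in\mathbb R^d$ (all quantities may depend on $d$; the dependence is not displayed). Let $M$ and $N$ be functions of $A$, i.e. $M=Q\,\mathrm{diag}(f(\lambda_i^2))\,Q^T$ and $N=Q\,\mathrm{diag}(h(\lambda_i^2))\,Q^T$ for some $f,h:\mathbb R\to\mathbb R$, such that $\mathcal A:=M-N$ and the noise covariance $M^T+N$ are positive definite, and put $G:=M^{-1}N$. Consider the Metropolis--Hastings algorithm with target $N(A^{-1}b,A^{-1})$, with density $\pi$, and proposal $$y=Gx+M^{-1}\beta+(\mathcal A^{-1}-G\mathcal A^{-1}G^T)^{1/2}\xi,\qquad \xi\sim N(0,I)\ \text{independent of }x,$$ with transition density $q(x,y)$, and let $\alpha(x,y)=1\wedge\frac{\pi(y)q(y,x)}{\pi(x)q(x,y)}$. Suppose the chain is in equilibrium, i.e. $x\sim N(A^{-1}b,A^{-1})$. Let $\tilde\lambda_i^2$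 and $G_i$ be the eigenvalues of $\mathcal A$ and $G$ belonging to the $i$-th column of $Q$, and define $\tilde g_i=1-G_i$, $g_i=1-G_i^2$, $m_i=(Q^TA^{-1}b)_i$, $\tilde m_i=(Q^T\mathcal A^{-1}\beta)_i$, $r_i=(\lambda_i^2-\tilde\lambda_i^2)/\lambda_i^2$, $\tilde r_i=(\lambda_i^2-\tilde\lambda_i^2)/\tilde\lambda_i^2$, $\hat r_i=m_i-\tilde m_i$, and \begin{align*} T_{0i}&=\hat r_i^2\lambda_i^2(\tfrac12 r_ig_i-\tilde g_i), & T_{1i}&=\hat r_i\lambda_i(r_ig_i-\tilde g_i),\\ T_{2i}&=\hat r_i\lambda_i g_i^{1/2}(1+\tilde r_i)^{1/2}(1-r_iG_i), & T_{3i}&=\tfrac12 r_ig_i,\\ T_{4i}&=-\tfrac12 r_ig_i(1+\tilde r_i), & T_{5i}&=-r_iG_ig_i^{1/2}(1+\tilde r_i)^{1/2}. \end{align*} Let $\mu_i=T_{0i}+T_{3i}+T_{4i}$ and $\sigma_i^2=T_{1i}^2+T_{2i}^2+2T_{3i}^2+2T_{4i}^2+T_{5i}^2$, and assume that the limits $\mu=\lim_{d\to\infty}\sum_{i=1}^d\mu_i$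 and $\sigma^2=\lim_{d\to\infty}\sum_{i=1}^d\sigma_i^2$ exist and are finite, with $\sigma\ge0$. If there is a $\delta>0$ such that, for $j=1,2,3,4,5$ (with the convention $0/0=0$), $$\lim_{d\to\infty}\frac{\sum_{i=1}^d|T_{ji}|^{2+\delta}}{\left(\sum_{i=1}^d|T_{ji}|^2\right)^{1+\delta/2}}=0,$$ then, as $d\to\infty$, $$Z:=\log\left(\frac{\pi(y)q(y,x)}{\pi(x)q(x,y)}\right)\xrightarrow{\mathcal D}N(\mu,\sigma^2),$$ where $N(\mu,0)$ is the point mass at $\mu$. Hence, if $\sigma>0$, the expected acceptance rate satisfies $$\mathrm E[\alpha(x,y)]\to\Phi\left(\tfrac{\mu}{\sigma}\right)+e^{\mu+\sigma^2/2}\,\Phi\left(-\sigma-\tfrac{\mu}{\sigma}\right),$$ where $\Phi$ is the standard normal cumulative distribution function. -/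

import Mathlib

open MeasureTheory ProbabilityTheory Filter Topology
open scoped Matrix MatrixOrder

noncomputable section

namespace SplittingMH

/-- `ℝ^d` with its Euclidean structure. -/
abbrev E (d : ℕ) := EuclideanSpace ℝ (Fin d)

/-- The matrix-vector product `B x`, for `x` in `ℝ^d`. -/
def act {d : ℕ} (B : Matrix (Fin d) (Fin d) ℝ) (x : E d) : E d :=
  Matrix.toEuclideanCLM (n := Fin d) (𝕜 := ℝ) B x

/-- `B` is a function of the symmetric matrix `A`: if `A = Q diag(a_i) Qᵀ` with `Q` orthogonal,
then `B = Q diag(f(a_i)) Qᵀ` for some `f : ℝ → ℝ` (functional calculus; every `f` is continuous on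
the finite spectrum of `A`, so no regularity of `f` is needed). -/
def IsFunctionOf {d : ℕ} (B A : Matrix (Fin d) (Fin d) ℝ) : Prop :=
  ∃ f : ℝ → ℝ, B = cfc f A

/-- The density of `N(m, S)` with respect to Lebesgue measure on `ℝ^d`
(for positive definite `S`). -/
def gaussianDensity {d : ℕ} (m : E d) (S : Matrix (Fin d) (Fin d) ℝ) (x : E d) : ℝ :=
  (Real.sqrt ((2 * Real.pi) ^ d * S.det))⁻¹ *
    Real.exp (-(1 / 2) * inner ℝ (x - m) (act S⁻¹ (x - m)))

/-- The iteration matrix `G = M⁻¹ N` of the splitting `M - N`. -/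
def iterMatrix {d : ℕ} (M N : Matrix (Fin d) (Fin d) ℝ) : Matrix (Fin d) (Fin d) ℝ :=
  M⁻¹ * N

/-- The proposal covariance `𝒜⁻¹ - G 𝒜⁻¹ Gᵀ`, where `𝒜 = M - N`. -/
def proposalCov {d : ℕ} (M N : Matrix (Fin d) (Fin d) ℝ) : Matrix (Fin d) (Fin d) ℝ :=
  (M - N)⁻¹ - iterMatrix M N * (M - N)⁻¹ * (iterMatrix M N)ᵀ

/-- The conditional mean `G x + M⁻¹ β` of the proposal at the state `x`. -/
def proposalMean {d : ℕ} (M N : Matrix (Fin d) (Fin d) ℝ) (β x : E d) : E d :=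
  act (iterMatrix M N) x + act M⁻¹ β

/-- The proposal `y = G x + M⁻¹ β + (𝒜⁻¹ - G 𝒜⁻¹ Gᵀ)^{1/2} ξ` at the state `x`, where `ξ` is the
driving noise. -/
def proposal {d : ℕ} (M N : Matrix (Fin d) (Fin d) ℝ) (β x ξ : E d) : E d :=
  proposalMean M N β x + act (CFC.sqrt (proposalCov M N)) ξ

/-- The target density `π(x)`, that of `N(A⁻¹ b, A⁻¹)`. -/
def targetDensity {d : ℕ} (A : Matrix (Fin d) (Fin d) ℝ) (b x : E d) : ℝ :=
  gaussianDensity (act A⁻¹ b) A⁻¹ x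

/-- The proposal transition density `q(x, y)`: density at `y` of the proposal from state `x`. -/
def proposalDensity {d : ℕ} (M N : Matrix (Fin d) (Fin d) ℝ) (β x y : E d) : ℝ :=
  gaussianDensity (proposalMean M N β x) (proposalCov M N) y

/-- The Metropolis-Hastings ratio `π(y) q(y, x) / (π(x) q(x, y))`. -/
def mhRatio {d : ℕ} (A M N : Matrix (Fin d) (Fin d) ℝ) (b β x y : E d) : ℝ :=
  (targetDensity A b y * proposalDensity M N β y x) /
    (targetDensity A b x * proposalDensity M N β x y)

/-- The log acceptance ratio. -/
def logRatio {d : ℕ} (A M N : Matrix (Fin d) (Fin d) ℝ) (b β x y : E d) : ℝ :=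
  Real.log (mhRatio A M N b β x y)

/-- The acceptance probability `α(x, y)`. -/
def acceptProb {d : ℕ} (A M N : Matrix (Fin d) (Fin d) ℝ) (b β x y : E d) : ℝ :=
  min 1 (mhRatio A M N b β x y)

/-- `(Qᵀ B Q)_{ii}`. When the `i`-th column `q_i` of the orthogonal matrix `Q` is an eigenvector of
`B`, this is the eigenvalue of `B` on `q_i`; see `eigAlong_eq`; by
`cfc_eq_conj_diagonal` this holds for every function of a matrix diagonalized by `Q`. -/
def eigAlong {d : ℕ} (Q B : Matrix (Fin d) (Fin d) ℝ) (i : Fin d) : ℝ :=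
  (Qᵀ * B * Q) i i

/-- `(Qᵀ v)_i`, the `i`-th coordinate of `v` in the basis formed by the columns of `Q`. -/
def coordAlong {d : ℕ} (Q : Matrix (Fin d) (Fin d) ℝ) (v : E d) (i : Fin d) : ℝ :=
  act Qᵀ v i

/-- The coefficients `T_0, …, T_5` as functions of `lam` (`λ_i`), `c` (`λ̃_i²`, the eigenvalue of
`𝒜`), `G` (`G_i`, the eigenvalue of the iteration matrix) and `rhat` (`m_i - m̃_i`). -/
def coefT (lam c G rhat : ℝ) : Fin 6 → ℝ :=
  let gt := 1 - G
  let g := 1 - G ^ 2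
  let r := (lam ^ 2 - c) / lam ^ 2
  let rt := (lam ^ 2 - c) / c
  ![rhat ^ 2 * lam ^ 2 * (1 / 2 * r * g - gt),
    rhat * lam * (r * g - gt),
    rhat * lam * Real.sqrt g * Real.sqrt (1 + rt) * (1 - r * G),
    1 / 2 * r * g,
    -(1 / 2) * r * g * (1 + rt),
    -r * G * Real.sqrt g * Real.sqrt (1 + rt)]

/-- The mean contribution `T_0 + T_3 + T_4`. -/
def meanOf (T : Fin 6 → ℝ) : ℝ := T 0 + T 3 + T 4

/-- The variance contribution `T_1² + T_2² + 2 T_3² + 2 T_4² + T_5²`. -/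
def varOf (T : Fin 6 → ℝ) : ℝ :=
  T 1 ^ 2 + T 2 ^ 2 + 2 * T 3 ^ 2 + 2 * T 4 ^ 2 + T 5 ^ 2

/-- The coefficients `T_{ji}` of the splitting `𝒜 = M - N` for the target `N(A⁻¹ b, A⁻¹)`, where
`A = Q diag(lam_1², …, lam_d²) Qᵀ`. -/
def splitT {d : ℕ} (A M N : Matrix (Fin d) (Fin d) ℝ) (b β : E d)
    (Q : Matrix (Fin d) (Fin d) ℝ) (lam : Fin d → ℝ) (i : Fin d) : Fin 6 → ℝ :=
  coefT (lam i) (eigAlong Q (M - N) i) (eigAlong Q (iterMatrix M N) i)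
    (coordAlong Q (act A⁻¹ b) i - coordAlong Q (act (M - N)⁻¹ β) i)

/-- The standard normal cumulative distribution function. -/
def stdNormalCDF (t : ℝ) : ℝ := cdf (gaussianReal 0 1) t

theorem eigAlong_eq {d : ℕ} {Q B : Matrix (Fin d) (Fin d) ℝ} (hQ : Qᵀ * Q = 1) {i : Fin d} {c : ℝ}
    (h : B *ᵥ Q.col i = c • Q.col i) : eigAlong Q B i = c := by
  have h1 : (B * Q).col i = c • Q.col i := by
    rw [← h]; ext k; simp [Matrix.mul_apply, Matrix.mulVec, dotProduct]
  have h2 := congrFun (congrFun hQ i) i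
  rw [Matrix.mul_apply] at h2
  unfold eigAlong
  rw [Matrix.mul_assoc, Matrix.mul_apply]
  have h3 : ∀ k, (B * Q) k i = c * Q k i := fun k => congrFun h1 k
  simp only [h3]
  calc ∑ k, Qᵀ i k * (c * Q k i) = c * ∑ k, Qᵀ i k * Q k i := by
        rw [Finset.mul_sum]; exact Finset.sum_congr rfl fun k _ => by ring
    _ = c := by rw [h2]; simp

theorem cfc_eq_conj_diagonal {d : ℕ} {Q A : Matrix (Fin d) (Fin d) ℝ} {a : Fin d → ℝ}
    (hQ : Q ∈ Matrix.orthogonalGroup (Fin d) ℝ) (hA : A = Q * Matrix.diagonal a * Qᵀ)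
    (f : ℝ → ℝ) : cfc f A = Q * Matrix.diagonal (fun i => f (a i)) * Qᵀ := by
  have key : ∀ v : Fin d → ℝ, Q * Matrix.diagonal v * Qᵀ =
      Unitary.conjStarAlgAut ℝ _ ⟨Q, hQ⟩ (Matrix.diagonal v) := by
    intro v; rw [Unitary.conjStarAlgAut_apply]; rfl
  have hsa : IsSelfAdjoint A := by
    rw [hA]
    change (Q * Matrix.diagonal a * Qᵀ)ᴴ = _
    simp [Matrix.mul_assoc]
  set p := Lagrange.interpolate (Finset.univ.image a) id f with hp
  have hpe : ∀ i, p.eval (a i) = f (a i) := fun i =>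
    Lagrange.eval_interpolate_at_node f Function.injective_id.injOn
      (Finset.mem_image_of_mem a (Finset.mem_univ i))
  have hspec : spectrum ℝ A ⊆ Set.range a := by
    rw [hA, key, AlgEquiv.spectrum_eq, spectrum_diagonal]
  have h1 : cfc f A = cfc p.eval A := by
    refine cfc_congr fun t ht => ?_
    obtain ⟨i, rfl⟩ := hspec ht
    exact (hpe i).symm
  have h2 : cfc p.eval A = Polynomial.aeval A p := cfc_polynomial p A
  rw [h1, h2, key, hA, key, Polynomial.aeval_algHom_apply]
  congr 1
  have := Polynomial.aeval_algHom_apply (Matrix.diagonalAlgHom (n := Fin d) (α := ℝ) ℝ) a p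
  simp only [Matrix.diagonalAlgHom_apply] at this
  rw [this]
  congr 1
  ext i
  rw [← hpe i]
  simp

end SplittingMH

end

/-!
The matrices `A`, `M` and `N` are diagonalized by the same orthogonal `Q`, so in the coordinates
along the columns of `Q` the Metropolis-Hastings ratio factorizes. Write `u` for the whitened state,
`u i = λ_i (Qᵀ (x - A⁻¹ b))_i`, and `v = Qᵀ ξ`; these are independent standard Gaussian vectors
(`hasLaw_whitened_multivariateGaussian`, `hasLaw_coordAlong_stdGaussian`, `hasLaw_pairs`). The
proposal kernel is reversible for `N(𝒜⁻¹ β, 𝒜⁻¹)`, so the `i`-th coordinate contributes a quadratic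
polynomial in `(u i, v i)` to the log acceptance ratio, and its coefficients are the `T_{ji}`
(`coordinate_logRatio_eq`, `mhRatio_pos_and_logRatio_eq`). In terms of the orthogonal polynomials
`u`, `v`, `u² - 1`, `v² - 1`, `u v` its mean is `meanOf` and its variance `varOf`.

It remains to prove a central limit theorem for the row sums of a triangular array. Since the
variances converge, the Lyapunov ratios force every `∑ i, |T_{ji}| ^ k` with `k > 2` to vanish in
the limit (`tendsto_sum_abs_pow_of_lyapunov`), whatever `δ > 0` is. Third absolute moments of the
summands are bounded by the cubes of the coefficients, so each characteristic function is
`1 - t² varOf / 2` up to an error, and the errors of a row sum to `o(1)`; the product converges to the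
Gaussian characteristic function (`tendsto_prod_exp_of_second_order`), and Lévy's continuity theorem
concludes. This covers `σ = 0` without a separate argument.

The acceptance probability is the bounded continuous function `z ↦ min 1 (exp z)` of the log ratio,
so its expectation converges to the Gaussian integral of that function, which is evaluated by
exponential tilting (`integral_min_one_exp_gaussianReal`).
-/

namespace SplittingMH

/-! ### Products of characteristic functions -/

theorem norm_cexp_mul_I_sub_taylor_two_le (y : ℝ) :
    ‖Complex.exp (y * Complex.I) - (1 + y * Complex.I - y ^ 2 / 2)‖ ≤ 4 * |y| ^ 3 := by
  -- the exponential series for small `y`, the triangle inequality for large `y`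
  rcases le_total |y| 1 with h | h
  · have hz : ‖(y * Complex.I : ℂ)‖ = |y| := by simp
    have hb := Complex.exp_bound (x := (y * Complex.I : ℂ)) (by rw [hz]; exact h)
      (n := 3) (by norm_num)
    rw [hz] at hb
    have hs : ∑ m ∈ Finset.range 3, (y * Complex.I : ℂ) ^ m / (m.factorial : ℂ)
        = 1 + y * Complex.I - y ^ 2 / 2 := by
      simp [Finset.sum_range_succ, Nat.factorial, mul_pow]
      ring
    rw [hs] at hb
    refine hb.trans ?_
    rw [mul_comm]
    have : 0 ≤ |y| ^ 3 := by positivity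
    gcongr
    norm_num [Nat.factorial]
  · have h1 : ‖Complex.exp (y * Complex.I)‖ = 1 := Complex.norm_exp_ofReal_mul_I y
    have h2 : ‖(1 + y * Complex.I - y ^ 2 / 2 : ℂ)‖ ≤ 1 + |y| + |y| ^ 2 / 2 := by
      refine (norm_sub_le _ _).trans (add_le_add ((norm_add_le _ _).trans ?_) ?_) <;> simp
    have h3 : |y| ≤ |y| ^ 3 := le_self_pow₀ h (by norm_num)
    have h4 : |y| ^ 2 ≤ |y| ^ 3 := pow_le_pow_right₀ h (by norm_num)
    have h5 := norm_sub_le (Complex.exp (y * Complex.I)) (1 + y * Complex.I - y ^ 2 / 2 : ℂ)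
    linarith

theorem norm_prod_sub_prod_le_sum {ι : Type*} (s : Finset ι) {f g : ι → ℂ}
    (hf : ∀ i ∈ s, ‖f i‖ ≤ 1) (hg : ∀ i ∈ s, ‖g i‖ ≤ 1) :
    ‖∏ i ∈ s, f i - ∏ i ∈ s, g i‖ ≤ ∑ i ∈ s, ‖f i - g i‖ := by
  classical
  induction s using Finset.induction_on with
  | empty => simp
  | insert a s ha ih =>
    rw [Finset.prod_insert ha, Finset.prod_insert ha, Finset.sum_insert ha]
    have h1 : ‖∏ i ∈ s, g i‖ ≤ 1 := by
      rw [norm_prod]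
      exact Finset.prod_le_one (fun _ _ => norm_nonneg _)
        fun i hi => hg i (Finset.mem_insert_of_mem hi)
    have h2 := ih (fun i hi => hf i (Finset.mem_insert_of_mem hi))
      fun i hi => hg i (Finset.mem_insert_of_mem hi)
    calc ‖f a * ∏ i ∈ s, f i - g a * ∏ i ∈ s, g i‖
        = ‖f a * (∏ i ∈ s, f i - ∏ i ∈ s, g i) + (f a - g a) * ∏ i ∈ s, g i‖ := by
          congr 1; ring
      _ ≤ ‖f a‖ * ‖∏ i ∈ s, f i - ∏ i ∈ s, g i‖ + ‖f a - g a‖ * ‖∏ i ∈ s, g i‖ := by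
          rw [← norm_mul, ← norm_mul]; exact norm_add_le _ _
      _ ≤ 1 * ‖∏ i ∈ s, f i - ∏ i ∈ s, g i‖ + ‖f a - g a‖ * 1 := by
          gcongr
          exact hf a (Finset.mem_insert_self a s)
      _ ≤ _ := by linarith

theorem abs_one_sub_sub_exp_neg_le {y : ℝ} (hy : 0 ≤ y) : |1 - y - Real.exp (-y)| ≤ y ^ 2 := by
  have h1 : 1 - y ≤ Real.exp (-y) := by linarith [Real.add_one_le_exp (-y)]
  have h2 : Real.exp (-y) ≤ 1 - y + y ^ 2 := by
    rw [Real.exp_neg, inv_le_iff_one_le_mul₀ (Real.exp_pos y)]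
    have h3 : 1 + y ≤ Real.exp y := by linarith [Real.add_one_le_exp y]
    have h4 : 0 < 1 - y + y ^ 2 := by nlinarith [sq_nonneg (y - 1)]
    have h5 : 0 ≤ y ^ 3 := by positivity
    nlinarith [mul_le_mul_of_nonneg_left h3 h4.le]
  rw [abs_le]
  constructor <;> linarith [sq_nonneg y]

/-- The analytic core of Lyapunov's theorem for triangular arrays: if each factor of a product is
`1 - s / 2` up to an error, the errors and the squares of the `s` sum to `o(1)`, and the `s` sum to
`S + o(1)`, then the product tends to `exp (-S / 2)`. -/
theorem tendsto_prod_exp_of_second_order {ι : ℕ → Type*} [∀ n, Fintype (ι n)]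
    {φ : ∀ n, ι n → ℂ} {s r : ∀ n, ι n → ℝ} {S : ℝ}
    (hφ : ∀ n i, ‖φ n i‖ ≤ 1) (hs : ∀ n i, 0 ≤ s n i)
    (hr : ∀ n i, ‖φ n i - (1 - s n i / 2 : ℝ)‖ ≤ r n i)
    (hr0 : Tendsto (fun n => ∑ i, r n i) atTop (𝓝 0))
    (hs2 : Tendsto (fun n => ∑ i, s n i ^ 2) atTop (𝓝 0))
    (hS : Tendsto (fun n => ∑ i, s n i) atTop (𝓝 S)) :
    Tendsto (fun n => ∏ i, φ n i) atTop (𝓝 (Real.exp (-(S / 2)) : ℝ)) := by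
  have hexp : Tendsto (fun n => ∏ i, ((Real.exp (-(s n i / 2)) : ℝ) : ℂ)) atTop
      (𝓝 (Real.exp (-(S / 2)) : ℝ)) := by
    have : ∀ n, ∏ i, ((Real.exp (-(s n i / 2)) : ℝ) : ℂ)
        = ((Real.exp (-((∑ i, s n i) / 2)) : ℝ) : ℂ) := by
      intro n
      rw [← Complex.ofReal_prod, ← Real.exp_sum, Finset.sum_neg_distrib, Finset.sum_div]
    simp_rw [this]
    exact (Complex.continuous_ofReal.tendsto _).comp
      ((Real.continuous_exp.tendsto _).comp ((hS.div_const 2).neg))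
  have hbound : ∀ n, ‖∏ i, φ n i - ∏ i, ((Real.exp (-(s n i / 2)) : ℝ) : ℂ)‖
      ≤ ∑ i, r n i + ∑ i, s n i ^ 2 := by
    intro n
    refine (norm_prod_sub_prod_le_sum _ (fun i _ => hφ n i) fun i _ => ?_).trans ?_
    · rw [Complex.norm_real, Real.norm_eq_abs, Real.abs_exp, Real.exp_le_one_iff]
      linarith [hs n i]
    · rw [← Finset.sum_add_distrib]
      refine Finset.sum_le_sum fun i _ => ?_
      have h1 := abs_one_sub_sub_exp_neg_le (y := s n i / 2) (by linarith [hs n i])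
      have h2 : ‖((1 - s n i / 2 : ℝ) : ℂ) - (Real.exp (-(s n i / 2)) : ℝ)‖ ≤ s n i ^ 2 := by
        rw [← Complex.ofReal_sub, Complex.norm_real, Real.norm_eq_abs]
        nlinarith [sq_nonneg (s n i)]
      have h3 := norm_sub_le_norm_sub_add_norm_sub (φ n i) ((1 - s n i / 2 : ℝ) : ℂ)
        ((Real.exp (-(s n i / 2)) : ℝ) : ℂ)
      linarith [hr n i]
  have hdiff : Tendsto (fun n => ∏ i, φ n i - ∏ i, ((Real.exp (-(s n i / 2)) : ℝ) : ℂ)) atTop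
      (𝓝 0) :=
    squeeze_zero_norm hbound (by simpa using hr0.add hs2)
  simpa using hdiff.add hexp

/-! ### Consequences of the Lyapunov condition -/

/-- The Lyapunov ratio condition together with bounded sums of squares makes the entries of a
triangular array uniformly small, so every power sum of order above two vanishes in the limit. -/
theorem tendsto_sum_abs_pow_of_lyapunov {ι : ℕ → Type*} [∀ n, Fintype (ι n)]
    {a : ∀ n, ι n → ℝ} {δ : ℝ} (hδ : 0 < δ)
    (h : Tendsto (fun n => (∑ i, |a n i| ^ (2 + δ)) / (∑ i, |a n i| ^ 2) ^ (1 + δ / 2))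
      atTop (𝓝 0))
    {K : ℝ} (hK : ∀ᶠ n in atTop, ∑ i, |a n i| ^ 2 ≤ K) {k : ℕ} (hk : k ≠ 0) :
    Tendsto (fun n => ∑ i, |a n i| ^ (k + 2)) atTop (𝓝 0) := by
  have hnum : Tendsto (fun n => ∑ i, |a n i| ^ (2 + δ)) atTop (𝓝 0) := by
    have hlim : Tendsto (fun n => (∑ i, |a n i| ^ (2 + δ)) / (∑ i, |a n i| ^ 2) ^ (1 + δ / 2)
        * K ^ (1 + δ / 2)) atTop (𝓝 0) := by simpa using h.mul_const (K ^ (1 + δ / 2))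
    refine squeeze_zero' (.of_forall fun n => by positivity) ?_ hlim
    filter_upwards [hK] with n hn
    have hQ0 : 0 ≤ ∑ i, |a n i| ^ 2 := by positivity
    rcases hQ0.eq_or_lt with h0 | h0
    · -- a vanishing denominator forces all entries of the row to vanish
      have hz : ∀ i, a n i = 0 := fun i => by
        have := (Finset.sum_eq_zero_iff_of_nonneg
          (fun i _ => by positivity : ∀ i ∈ Finset.univ, 0 ≤ |a n i| ^ 2)).1 h0.symm i
          (Finset.mem_univ i)
        simpa using this
      have h2δ : (2 + δ : ℝ) ≠ 0 := by positivity
      simp [hz, Real.zero_rpow h2δ]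
    · have hpos : 0 < (∑ i, |a n i| ^ 2) ^ (1 + δ / 2) := Real.rpow_pos_of_pos h0 _
      rw [div_mul_eq_mul_div, le_div_iff₀ hpos]
      gcongr
  -- `τ n` bounds every entry of row `n`
  set τ : ℕ → ℝ := fun n => (∑ i, |a n i| ^ (2 + δ)) ^ (2 + δ)⁻¹ with hτ
  have hτ0 : Tendsto τ atTop (𝓝 0) := by
    have := (Real.continuousAt_rpow_const 0 ((2 + δ)⁻¹) (.inr (by positivity))).tendsto.comp hnum
    rwa [Real.zero_rpow (by positivity)] at this
  have hle : ∀ n i, |a n i| ≤ τ n := by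
    intro n i
    rw [hτ, Real.le_rpow_inv_iff_of_pos (by positivity) (by positivity) (by positivity)]
    exact Finset.single_le_sum (f := fun i => |a n i| ^ (2 + δ)) (fun _ _ => by positivity)
      (Finset.mem_univ i)
  have hlim : Tendsto (fun n => τ n ^ k * K) atTop (𝓝 0) := by
    simpa [hk] using (hτ0.pow k).mul_const K
  refine squeeze_zero' (.of_forall fun n => by positivity) ?_ hlim
  filter_upwards [hK] with n hn
  have hτn : 0 ≤ τ n := by positivity
  calc ∑ i, |a n i| ^ (k + 2) ≤ ∑ i, τ n ^ k * |a n i| ^ 2 := by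
        refine Finset.sum_le_sum fun i _ => ?_
        rw [pow_add]
        gcongr
        exact hle n i
    _ = τ n ^ k * ∑ i, |a n i| ^ 2 := by rw [Finset.mul_sum]
    _ ≤ τ n ^ k * K := by gcongr

/-! ### Quadratic polynomials in a pair of independent standard normals -/

theorem integral_pow_gaussianReal_zero_one (k : ℕ) :
    ∫ x : ℝ, x ^ k ∂(gaussianReal 0 1) =
      iteratedDeriv k (fun t : ℝ => Real.exp (t ^ 2 / 2)) 0 := by
  have h := iteratedDeriv_mgf_zero (X := id) (μ := gaussianReal 0 1) (by simp) k
  rw [mgf_id_gaussianReal] at h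
  simpa using h.symm

/-- The first four moments of the standard normal law, read off from the derivatives of its moment
generating function. -/
theorem integral_stdNormal_moments :
    ∫ x : ℝ, x ∂(gaussianReal 0 1) = 0 ∧ ∫ x : ℝ, x ^ 2 ∂(gaussianReal 0 1) = 1 ∧
    ∫ x : ℝ, x ^ 3 ∂(gaussianReal 0 1) = 0 ∧ ∫ x : ℝ, x ^ 4 ∂(gaussianReal 0 1) = 3 := by
  have hE : ∀ t : ℝ, HasDerivAt (fun t : ℝ => Real.exp (t ^ 2 / 2)) (t * Real.exp (t ^ 2 / 2)) t := by
    intro t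
    have h : HasDerivAt (fun t : ℝ => t ^ 2 / 2) t t := by
      simpa using ((hasDerivAt_pow 2 t).div_const 2)
    simpa [mul_comm] using h.exp
  have d1 : deriv (fun t : ℝ => Real.exp (t ^ 2 / 2)) = fun t => t * Real.exp (t ^ 2 / 2) :=
    funext fun t => (hE t).deriv
  have d2 : deriv (fun t : ℝ => t * Real.exp (t ^ 2 / 2)) =
      fun t => (1 + t ^ 2) * Real.exp (t ^ 2 / 2) :=
    funext fun t => by rw [((hasDerivAt_id' t).fun_mul (hE t)).deriv]; ring
  have d3 : deriv (fun t : ℝ => (1 + t ^ 2) * Real.exp (t ^ 2 / 2)) =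
      fun t => (3 * t + t ^ 3) * Real.exp (t ^ 2 / 2) :=
    funext fun t => by
      rw [(((hasDerivAt_pow 2 t).const_add 1).fun_mul (hE t)).deriv]; push_cast; ring
  have d4 : deriv (fun t : ℝ => (3 * t + t ^ 3) * Real.exp (t ^ 2 / 2)) =
      fun t => (3 + 6 * t ^ 2 + t ^ 4) * Real.exp (t ^ 2 / 2) :=
    funext fun t => by
      rw [((((hasDerivAt_id' t).const_mul 3).fun_add (hasDerivAt_pow 3 t)).fun_mul (hE t)).deriv]
      push_cast; ring
  refine ⟨by simp, ?_, ?_, ?_⟩ <;> rw [integral_pow_gaussianReal_zero_one] <;>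
    simp [iteratedDeriv_succ', d1, d2, d3, d4]

theorem integrable_pow_stdNormal (k : ℕ) :
    Integrable (fun x : ℝ => x ^ k) (gaussianReal 0 1) := by
  have h := (memLp_id_gaussianReal (μ := 0) (v := 1) (k : NNReal)).integrable_norm_pow'
  refine h.congr' (by fun_prop) (.of_forall fun x => ?_)
  simp

theorem integrable_abs_pow_stdNormal (k : ℕ) :
    Integrable (fun x : ℝ => |x| ^ k) (gaussianReal 0 1) := by
  refine (integrable_pow_stdNormal k).congr' (by fun_prop) (.of_forall fun x => ?_)
  simp

/-- The integral of a quartic polynomial against the standard normal law. -/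
theorem integral_quartic_stdNormal (c₀ c₁ c₂ c₃ c₄ : ℝ) :
    ∫ x : ℝ, c₀ + c₁ * x + c₂ * x ^ 2 + c₃ * x ^ 3 + c₄ * x ^ 4 ∂(gaussianReal 0 1)
      = c₀ + c₂ + 3 * c₄ := by
  obtain ⟨m1, m2, m3, m4⟩ := integral_stdNormal_moments
  have i1 : Integrable (fun x : ℝ => x) (gaussianReal 0 1) := by
    simpa using integrable_pow_stdNormal 1
  have i0 : Integrable (fun _ : ℝ => c₀) (gaussianReal 0 1) := integrable_const _
  have i01 : Integrable (fun x : ℝ => c₀ + c₁ * x) (gaussianReal 0 1) := i0.add (i1.const_mul _)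
  have i2 : Integrable (fun x : ℝ => c₀ + c₁ * x + c₂ * x ^ 2) (gaussianReal 0 1) :=
    i01.add ((integrable_pow_stdNormal 2).const_mul _)
  have i3 : Integrable (fun x : ℝ => c₀ + c₁ * x + c₂ * x ^ 2 + c₃ * x ^ 3) (gaussianReal 0 1) :=
    i2.add ((integrable_pow_stdNormal 3).const_mul _)
  rw [integral_add i3 ((integrable_pow_stdNormal 4).const_mul _),
    integral_add i2 ((integrable_pow_stdNormal 3).const_mul _),
    integral_add i01 ((integrable_pow_stdNormal 2).const_mul _),
    integral_add i0 (i1.const_mul _)]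
  have e1 : ∫ x : ℝ, c₁ * x ∂(gaussianReal 0 1) = 0 := by
    rw [integral_const_mul c₁ (fun x : ℝ => x), m1, mul_zero]
  simp only [integral_const_mul, e1, m2, m3, m4]
  simp
  ring

/-- The joint law of a pair of independent standard normals. -/
noncomputable abbrev stdNormalPair : Measure (ℝ × ℝ) := (gaussianReal 0 1).prod (gaussianReal 0 1)

/-- The orthogonal polynomials `u`, `v`, `u² - 1`, `v² - 1`, `u v` in two independent standard
normals `u`, `v`. -/
noncomputable def hermitePair (j : Fin 5) (p : ℝ × ℝ) : ℝ :=
  (![p.1, p.2, p.1 ^ 2 - 1, p.2 ^ 2 - 1, p.1 * p.2] : Fin 5 → ℝ) j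

/-- The centred part of the quadratic polynomial with coefficients `T`; the constant coefficient
`T 0` plays no role. -/
noncomputable def centredQuad (T : Fin 6 → ℝ) (p : ℝ × ℝ) : ℝ :=
  ∑ j : Fin 5, T j.succ * hermitePair j p

theorem centredQuad_eq (T : Fin 6 → ℝ) (p : ℝ × ℝ) :
    centredQuad T p = T 1 * p.1 + T 2 * p.2 + T 3 * (p.1 ^ 2 - 1) + T 4 * (p.2 ^ 2 - 1)
      + T 5 * (p.1 * p.2) := by
  simp [centredQuad, hermitePair, Fin.sum_univ_succ]
  ring_nf

@[fun_prop]
theorem measurable_centredQuad (T : Fin 6 → ℝ) : Measurable (centredQuad T) := by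
  simp only [funext (centredQuad_eq T)]
  fun_prop

theorem integrable_abs_cube_hermitePair (j : Fin 5) :
    Integrable (fun p => |hermitePair j p| ^ 3) stdNormalPair := by
  have h1 : Integrable (fun _ : ℝ => (1 : ℝ)) (gaussianReal 0 1) := integrable_const _
  have h3 := integrable_abs_pow_stdNormal 3
  have hsq : Integrable (fun x : ℝ => |x ^ 2 - 1| ^ 3) (gaussianReal 0 1) := by
    have : Integrable (fun x : ℝ => 4 * |x| ^ 6 + 4) (gaussianReal 0 1) :=
      ((integrable_abs_pow_stdNormal 6).const_mul 4).add (integrable_const _)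
    refine this.mono' (by fun_prop) (.of_forall fun x => ?_)
    have ha : |x ^ 2 - 1| ≤ x ^ 2 + 1 := by
      rw [abs_le]; constructor <;> nlinarith [sq_nonneg x]
    have hb : |x ^ 2 - 1| ^ 3 ≤ (x ^ 2 + 1) ^ 3 := by gcongr
    have hc : |x| ^ 6 = (x ^ 2) ^ 3 := by rw [← sq_abs]; ring
    rw [Real.norm_eq_abs, abs_of_nonneg (by positivity), hc]
    nlinarith [sq_nonneg x, mul_nonneg (by positivity : 0 ≤ x ^ 2 + 1) (sq_nonneg (x ^ 2 - 1))]
  fin_cases j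
  · simpa [hermitePair] using h3.mul_prod h1
  · simpa [hermitePair] using h1.mul_prod h3
  · simpa [hermitePair] using hsq.mul_prod h1
  · simpa [hermitePair] using h1.mul_prod hsq
  · simpa [hermitePair, abs_mul, mul_pow] using h3.mul_prod h3

theorem abs_cube_centredQuad_le (T : Fin 6 → ℝ) (p : ℝ × ℝ) :
    |centredQuad T p| ^ 3 ≤ 25 * ∑ j : Fin 5, |T j.succ| ^ 3 * |hermitePair j p| ^ 3 := by
  have h1 : |centredQuad T p| ≤ ∑ j : Fin 5, |T j.succ * hermitePair j p| :=
    Finset.abs_sum_le_sum_abs _ _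
  have h2 := pow_sum_le_card_mul_sum_pow (s := (Finset.univ : Finset (Fin 5)))
    (f := fun j => |T j.succ * hermitePair j p|) (fun _ _ => abs_nonneg _) 2
  calc |centredQuad T p| ^ 3 ≤ (∑ j : Fin 5, |T j.succ * hermitePair j p|) ^ 3 := by gcongr
    _ ≤ _ := by
      refine h2.trans_eq ?_
      norm_num [abs_mul, mul_pow]

theorem integrable_abs_cube_centredQuad (T : Fin 6 → ℝ) :
    Integrable (fun p => |centredQuad T p| ^ 3) stdNormalPair := by
  refine Integrable.mono' (g := fun p =>
    25 * ∑ j : Fin 5, |T j.succ| ^ 3 * |hermitePair j p| ^ 3) ?_ (by fun_prop)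
    (.of_forall fun p => ?_)
  · exact (integrable_finsetSum _ fun j _ =>
      (integrable_abs_cube_hermitePair j).const_mul _).const_mul _
  · rw [Real.norm_eq_abs, abs_of_nonneg (by positivity)]
    exact abs_cube_centredQuad_le T p

/-- The third absolute moment of `centredQuad T` is controlled by the cubes of the coefficients. -/
theorem exists_integral_abs_cube_centredQuad_le :
    ∃ K : ℝ, 0 ≤ K ∧ ∀ T : Fin 6 → ℝ,
      ∫ p, |centredQuad T p| ^ 3 ∂stdNormalPair ≤ K * ∑ j : Fin 5, |T j.succ| ^ 3 := by
  refine ⟨25 * ∑ j : Fin 5, ∫ p, |hermitePair j p| ^ 3 ∂stdNormalPair, by positivity,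
    fun T => ?_⟩
  have hi : ∀ j : Fin 5, Integrable (fun p => |T j.succ| ^ 3 * |hermitePair j p| ^ 3)
      stdNormalPair := fun j => (integrable_abs_cube_hermitePair j).const_mul _
  calc ∫ p, |centredQuad T p| ^ 3 ∂stdNormalPair
      ≤ ∫ p, 25 * ∑ j : Fin 5, |T j.succ| ^ 3 * |hermitePair j p| ^ 3 ∂stdNormalPair :=
        integral_mono (integrable_abs_cube_centredQuad T)
          ((integrable_finsetSum _ fun j _ => hi j).const_mul _)
          (abs_cube_centredQuad_le T)
    _ = 25 * ∑ j : Fin 5, |T j.succ| ^ 3 * ∫ p, |hermitePair j p| ^ 3 ∂stdNormalPair := by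
        rw [integral_const_mul, integral_finsetSum _ fun j _ => hi j]
        simp only [integral_const_mul]
    _ ≤ 25 * ∑ j : Fin 5, |T j.succ| ^ 3 *
          ∑ k : Fin 5, ∫ p, |hermitePair k p| ^ 3 ∂stdNormalPair := by
        gcongr with j
        exact Finset.single_le_sum (f := fun k => ∫ p, |hermitePair k p| ^ 3 ∂stdNormalPair)
          (fun _ _ => by positivity) (Finset.mem_univ j)
    _ = _ := by rw [← Finset.sum_mul]; ring

theorem integrable_and_sq_of_abs_cube {α : Type*} [MeasurableSpace α] {ρ : Measure α}
    [IsFiniteMeasure ρ] {X : α → ℝ} (hX : Measurable X)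
    (h : Integrable (fun a => |X a| ^ 3) ρ) : Integrable X ρ ∧ Integrable (fun a => X a ^ 2) ρ := by
  have h' : Integrable (fun a => 1 + |X a| ^ 3) ρ := (integrable_const _).add h
  constructor
  · refine h'.mono' (by fun_prop) (.of_forall fun a => ?_)
    rw [Real.norm_eq_abs]
    rcases le_total |X a| 1 with h1 | h1
    · have : 0 ≤ |X a| ^ 3 := by positivity
      linarith
    · linarith [le_self_pow₀ h1 (show (3 : ℕ) ≠ 0 by norm_num)]
  · refine h'.mono' (by fun_prop) (.of_forall fun a => ?_)
    rw [Real.norm_eq_abs, abs_pow]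
    rcases le_total |X a| 1 with h1 | h1
    · have : |X a| ^ 2 ≤ 1 := pow_le_one₀ (abs_nonneg _) h1
      have : 0 ≤ |X a| ^ 3 := by positivity
      linarith
    · linarith [pow_le_pow_right₀ h1 (show 2 ≤ 3 by norm_num)]

/-- Integrating over the second variable first, both this mean and the second moment below reduce to
the integral of a quartic in one variable, twice. -/
theorem integral_centredQuad (T : Fin 6 → ℝ) : ∫ p, centredQuad T p ∂stdNormalPair = 0 := by
  have hi := (integrable_and_sq_of_abs_cube (measurable_centredQuad T)
    (integrable_abs_cube_centredQuad T)).1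
  have hinner : ∀ u : ℝ, ∫ v, centredQuad T (u, v) ∂(gaussianReal 0 1)
      = T 1 * u + T 3 * (u ^ 2 - 1) := by
    intro u
    have := integral_quartic_stdNormal (T 1 * u + T 3 * (u ^ 2 - 1) - T 4) (T 2 + T 5 * u) (T 4) 0 0
    convert this using 1
    · refine integral_congr_ae (.of_forall fun v => ?_)
      simp only [centredQuad_eq]; ring
    · ring
  rw [integral_prod _ hi]
  simp only [hinner]
  have := integral_quartic_stdNormal (-T 3) (T 1) (T 3) 0 0
  convert this using 1
  · refine integral_congr_ae (.of_forall fun v => ?_)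
    ring
  · ring

theorem integral_sq_centredQuad (T : Fin 6 → ℝ) :
    ∫ p, centredQuad T p ^ 2 ∂stdNormalPair = varOf T := by
  have hi := (integrable_and_sq_of_abs_cube (measurable_centredQuad T)
    (integrable_abs_cube_centredQuad T)).2
  have hinner : ∀ u : ℝ, ∫ v, centredQuad T (u, v) ^ 2 ∂(gaussianReal 0 1)
      = (T 1 * u + T 3 * (u ^ 2 - 1)) ^ 2 + 2 * T 4 ^ 2 + (T 2 + T 5 * u) ^ 2 := by
    intro u
    set a := T 1 * u + T 3 * (u ^ 2 - 1) - T 4 with ha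
    set b := T 2 + T 5 * u with hb
    have := integral_quartic_stdNormal (a ^ 2) (2 * a * b) (b ^ 2 + 2 * a * T 4) (2 * b * T 4)
      (T 4 ^ 2)
    convert this using 1
    · refine integral_congr_ae (.of_forall fun v => ?_)
      simp only [centredQuad_eq, ha, hb]; ring
    · rw [ha]; ring
  rw [integral_prod _ hi]
  simp only [hinner]
  have := integral_quartic_stdNormal (T 3 ^ 2 + 2 * T 4 ^ 2 + T 2 ^ 2)
    (-2 * T 1 * T 3 + 2 * T 2 * T 5) (T 1 ^ 2 - 2 * T 3 ^ 2 + T 5 ^ 2) (2 * T 1 * T 3) (T 3 ^ 2)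
  convert this using 1
  · refine integral_congr_ae (.of_forall fun v => ?_)
    ring
  · rw [varOf]; ring

/-- Second-order expansion of the characteristic function of a centred variable, with an error
bounded by the third absolute moment. -/
theorem norm_integral_cexp_sub_le {α : Type*} [MeasurableSpace α] {ρ : Measure α}
    [IsProbabilityMeasure ρ] {X : α → ℝ} (hX : Measurable X)
    (h3 : Integrable (fun a => |X a| ^ 3) ρ) (h0 : ∫ a, X a ∂ρ = 0) (t : ℝ) :
    ‖∫ a, Complex.exp ((t * X a : ℝ) * Complex.I) ∂ρ -
        ((1 - t ^ 2 * (∫ a, X a ^ 2 ∂ρ) / 2 : ℝ) : ℂ)‖ ≤ 4 * |t| ^ 3 * ∫ a, |X a| ^ 3 ∂ρ := by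
  obtain ⟨i1, i2⟩ := integrable_and_sq_of_abs_cube hX h3
  have ie : Integrable (fun a => Complex.exp ((t * X a : ℝ) * Complex.I)) ρ := by
    refine (integrable_const (1 : ℝ)).mono' (by fun_prop) (.of_forall fun a => ?_)
    rw [Complex.norm_exp_ofReal_mul_I]
  have ilin : Integrable (fun a => ((t * X a : ℝ) : ℂ) * Complex.I) ρ :=
    (i1.const_mul t).ofReal.mul_const _
  have isq : Integrable (fun a => ((t * X a : ℝ) : ℂ) ^ 2 / 2) ρ := by
    have : Integrable (fun a => ((t ^ 2 * X a ^ 2 : ℝ) : ℂ) / 2) ρ :=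
      (i2.const_mul (t ^ 2)).ofReal.div_const _
    refine this.congr (.of_forall fun a => ?_)
    push_cast; ring
  have ilin' : Integrable (fun a => 1 + ((t * X a : ℝ) : ℂ) * Complex.I) ρ :=
    (integrable_const _).add ilin
  have ipoly : Integrable (fun a => 1 + ((t * X a : ℝ) : ℂ) * Complex.I
      - ((t * X a : ℝ) : ℂ) ^ 2 / 2) ρ := ilin'.sub isq
  have hpoly : ∫ a, (1 + ((t * X a : ℝ) : ℂ) * Complex.I - ((t * X a : ℝ) : ℂ) ^ 2 / 2) ∂ρ
      = ((1 - t ^ 2 * (∫ a, X a ^ 2 ∂ρ) / 2 : ℝ) : ℂ) := by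
    rw [integral_sub ilin' isq, integral_add (integrable_const _) ilin,
      integral_mul_const, integral_div]
    have e1 : ∫ a, ((t * X a : ℝ) : ℂ) ∂ρ = 0 := by
      rw [integral_complex_ofReal, integral_const_mul, h0]; simp
    have e2 : ∫ a, ((t * X a : ℝ) : ℂ) ^ 2 ∂ρ = ((t ^ 2 * ∫ a, X a ^ 2 ∂ρ : ℝ) : ℂ) := by
      rw [← integral_const_mul, ← integral_complex_ofReal]
      refine integral_congr_ae (.of_forall fun a => ?_)
      push_cast; ring
    rw [e1, e2]
    simp
  rw [← hpoly, ← integral_sub ie ipoly, ← integral_const_mul]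
  refine norm_integral_le_of_norm_le (h3.const_mul _) (.of_forall fun a => ?_)
  refine (norm_cexp_mul_I_sub_taylor_two_le (t * X a)).trans_eq ?_
  rw [abs_mul, mul_pow, mul_assoc]

/-! ### The central limit theorem for sums of quadratic polynomials in normals -/

theorem varOf_nonneg (T : Fin 6 → ℝ) : 0 ≤ varOf T := by
  unfold varOf; positivity

theorem sq_le_varOf (T : Fin 6 → ℝ) (j : Fin 5) : |T j.succ| ^ 2 ≤ varOf T := by
  rw [sq_abs, varOf]
  fin_cases j <;> simp <;>
    nlinarith [sq_nonneg (T 1), sq_nonneg (T 2), sq_nonneg (T 3), sq_nonneg (T 4), sq_nonneg (T 5)]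

theorem sq_varOf_le (T : Fin 6 → ℝ) : varOf T ^ 2 ≤ 20 * ∑ j : Fin 5, |T j.succ| ^ 4 := by
  have h1 : 0 ≤ varOf T := varOf_nonneg T
  have h2 : varOf T ≤ 2 * ∑ j : Fin 5, |T j.succ| ^ 2 := by
    simp only [sq_abs, Fin.sum_univ_succ, varOf]
    simp
    nlinarith [sq_nonneg (T 1), sq_nonneg (T 2), sq_nonneg (T 3), sq_nonneg (T 4), sq_nonneg (T 5)]
  have h3 := sq_sum_le_card_mul_sum_sq (s := (Finset.univ : Finset (Fin 5)))
    (f := fun j => |T j.succ| ^ 2)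
  have h4 : ∀ j : Fin 5, (|T j.succ| ^ 2) ^ 2 = |T j.succ| ^ 4 := fun j => by ring
  simp only [h4, Finset.card_univ, Fintype.card_fin] at h3
  calc varOf T ^ 2 ≤ (2 * ∑ j : Fin 5, |T j.succ| ^ 2) ^ 2 := by gcongr
    _ = 4 * (∑ j : Fin 5, |T j.succ| ^ 2) ^ 2 := by ring
    _ ≤ 4 * ((5 : ℕ) * ∑ j : Fin 5, |T j.succ| ^ 4) := by gcongr
    _ = _ := by push_cast; ring

theorem measurable_sum_centredQuad {n : ℕ} (T : Fin n → Fin 6 → ℝ) :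
    Measurable fun p : Fin n → ℝ × ℝ => ∑ i, (meanOf (T i) + centredQuad (T i) (p i)) :=
  Finset.measurable_sum _ fun i _ =>
    ((measurable_centredQuad (T i)).comp (measurable_pi_apply i)).const_add _

/-- Independence across coordinates turns the characteristic function of the sum into a product. -/
theorem charFun_sum_centredQuad {n : ℕ} (T : Fin n → Fin 6 → ℝ) (t : ℝ) :
    charFun ((Measure.pi fun _ : Fin n => stdNormalPair).map
        fun p => ∑ i, (meanOf (T i) + centredQuad (T i) (p i))) t =
      Complex.exp ((t * ∑ i, meanOf (T i) : ℝ) * Complex.I) *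
        ∏ i, ∫ p, Complex.exp ((t * centredQuad (T i) p : ℝ) * Complex.I) ∂stdNormalPair := by
  rw [charFun_apply_real, integral_map (measurable_sum_centredQuad T).aemeasurable (by fun_prop),
    ← integral_fintype_prod_eq_prod (μ := fun _ : Fin n => stdNormalPair)
      (fun i p => Complex.exp ((t * centredQuad (T i) p : ℝ) * Complex.I)),
    ← integral_const_mul]
  refine integral_congr_ae (.of_forall fun p => ?_)
  simp only
  rw [← Complex.exp_sum, ← Complex.exp_add, Finset.sum_add_distrib]
  congr 1
  push_cast
  rw [← Finset.sum_mul, ← Finset.mul_sum]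
  ring

section LimitTheorem

variable {T : ∀ d : ℕ, Fin d → Fin 6 → ℝ} {δ μ σ : ℝ}

theorem tendsto_charFun_sum_centredQuad (hδ : 0 < δ)
    (hT : ∀ j : Fin 6, j ≠ 0 → Tendsto (fun d : ℕ =>
      (∑ i, |T d i j| ^ (2 + δ)) / (∑ i, |T d i j| ^ 2) ^ (1 + δ / 2)) atTop (𝓝 0))
    (hμ : Tendsto (fun d : ℕ => ∑ i, meanOf (T d i)) atTop (𝓝 μ))
    (hσ : Tendsto (fun d : ℕ => ∑ i, varOf (T d i)) atTop (𝓝 (σ ^ 2))) (t : ℝ) :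
    Tendsto (fun d : ℕ => charFun ((Measure.pi fun _ : Fin d => stdNormalPair).map
        fun p => ∑ i, (meanOf (T d i) + centredQuad (T d i) (p i))) t) atTop
      (𝓝 (charFun (gaussianReal μ (σ ^ 2).toNNReal) t)) := by
  obtain ⟨K, hK0, hK⟩ := exists_integral_abs_cube_centredQuad_le
  have hbdd : ∀ j : Fin 5, ∀ᶠ d in atTop, ∑ i, |T d i j.succ| ^ 2 ≤ σ ^ 2 + 1 := by
    intro j
    filter_upwards [hσ.eventually_le_const (show σ ^ 2 < σ ^ 2 + 1 by linarith)] with d hd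
    exact (Finset.sum_le_sum fun i _ => sq_le_varOf (T d i) j).trans hd
  have hpow : ∀ k : ℕ, k ≠ 0 →
      Tendsto (fun d => ∑ i, ∑ j : Fin 5, |T d i j.succ| ^ (k + 2)) atTop (𝓝 0) := by
    intro k hk
    have h := tendsto_finsetSum (Finset.univ : Finset (Fin 5)) fun j _ =>
      tendsto_sum_abs_pow_of_lyapunov hδ (hT j.succ (Fin.succ_ne_zero j)) (hbdd j) hk
    simp only [Finset.sum_const_zero] at h
    exact h.congr fun d => Finset.sum_comm
  have hprod := tendsto_prod_exp_of_second_order (ι := Fin) (S := t ^ 2 * σ ^ 2)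
    (φ := fun d i => ∫ p, Complex.exp ((t * centredQuad (T d i) p : ℝ) * Complex.I)
      ∂stdNormalPair)
    (s := fun d i => t ^ 2 * varOf (T d i))
    (r := fun d i => 4 * |t| ^ 3 * (K * ∑ j : Fin 5, |T d i j.succ| ^ 3))
    (fun d i => by
      refine (norm_integral_le_of_norm_le (integrable_const (1 : ℝ))
        (.of_forall fun p => (Complex.norm_exp_ofReal_mul_I _).le)).trans ?_
      simp)
    (fun d i => mul_nonneg (sq_nonneg t) (varOf_nonneg _))
    (fun d i => by
      have h := norm_integral_cexp_sub_le (measurable_centredQuad (T d i))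
        (integrable_abs_cube_centredQuad (T d i)) (integral_centredQuad (T d i)) t
      rw [integral_sq_centredQuad] at h
      refine h.trans ?_
      gcongr
      exact hK _)
    (by
      have := (hpow 1 one_ne_zero).const_mul (4 * |t| ^ 3 * K)
      rw [mul_zero] at this
      refine this.congr fun d => ?_
      rw [Finset.mul_sum]
      exact Finset.sum_congr rfl fun i _ => by ring)
    (by
      have := (hpow 2 two_ne_zero).const_mul (t ^ 4 * 20)
      rw [mul_zero] at this
      refine squeeze_zero (fun d => by positivity) (fun d => ?_) this
      rw [Finset.mul_sum]
      refine Finset.sum_le_sum fun i _ => ?_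
      have h := sq_varOf_le (T d i)
      have h4 : 0 ≤ t ^ 4 := by positivity
      nlinarith [mul_le_mul_of_nonneg_left h h4])
    (by simpa only [Finset.mul_sum] using hσ.const_mul (t ^ 2))
  have hmean : Tendsto (fun d : ℕ =>
      Complex.exp ((t * ∑ i, meanOf (T d i) : ℝ) * Complex.I)) atTop
      (𝓝 (Complex.exp ((t * μ : ℝ) * Complex.I))) := by
    have hc : Continuous fun m : ℝ => Complex.exp ((t * m : ℝ) * Complex.I) := by fun_prop
    exact (hc.tendsto μ).comp hμ
  simp only [charFun_sum_centredQuad]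
  convert hmean.mul hprod using 2
  rw [charFun_gaussianReal, Complex.ofReal_exp, ← Complex.exp_add]
  congr 1
  rw [Real.coe_toNNReal _ (sq_nonneg σ)]
  push_cast
  ring

/-- **Lyapunov's central limit theorem** for row sums of quadratic polynomials in independent
standard normal pairs, including the degenerate case `σ = 0`. -/
theorem tendstoInDistribution_sum_centredQuad
    {Ω : ℕ → Type*} [∀ d, MeasurableSpace (Ω d)] {P : ∀ d, Measure (Ω d)}
    [∀ d, IsProbabilityMeasure (P d)] {p : ∀ d, Ω d → Fin d → ℝ × ℝ}
    (hp : ∀ d, HasLaw (p d) (Measure.pi fun _ : Fin d => stdNormalPair) (P d)) (hδ : 0 < δ)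
    (hT : ∀ j : Fin 6, j ≠ 0 → Tendsto (fun d : ℕ =>
      (∑ i, |T d i j| ^ (2 + δ)) / (∑ i, |T d i j| ^ 2) ^ (1 + δ / 2)) atTop (𝓝 0))
    (hμ : Tendsto (fun d : ℕ => ∑ i, meanOf (T d i)) atTop (𝓝 μ))
    (hσ : Tendsto (fun d : ℕ => ∑ i, varOf (T d i)) atTop (𝓝 (σ ^ 2))) :
    TendstoInDistribution
      (fun d ω => ∑ i, (meanOf (T d i) + centredQuad (T d i) (p d ω i)))
      atTop (id : ℝ → ℝ) P (gaussianReal μ (σ ^ 2).toNNReal) := by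
  have hlaw : ∀ d, HasLaw (fun ω => ∑ i, (meanOf (T d i) + centredQuad (T d i) (p d ω i)))
      ((Measure.pi fun _ : Fin d => stdNormalPair).map
        fun q => ∑ i, (meanOf (T d i) + centredQuad (T d i) (q i))) (P d) := by
    intro d
    have hY : HasLaw (fun q : Fin d → ℝ × ℝ => ∑ i, (meanOf (T d i) + centredQuad (T d i) (q i)))
        ((Measure.pi fun _ : Fin d => stdNormalPair).map
          fun q => ∑ i, (meanOf (T d i) + centredQuad (T d i) (q i)))
        (Measure.pi fun _ : Fin d => stdNormalPair) :=
      ⟨(measurable_sum_centredQuad (T d)).aemeasurable, rfl⟩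
    exact hY.comp (hp d)
  refine ⟨fun d => (hlaw d).aemeasurable, by fun_prop, ?_⟩
  refine ProbabilityMeasure.tendsto_iff_tendsto_charFun.2 fun t => ?_
  simp only [ProbabilityMeasure.coe_mk, Measure.map_id, (hlaw _).map_eq]
  exact tendsto_charFun_sum_centredQuad hδ hT hμ hσ t

end LimitTheorem

/-! ### The limiting acceptance rate -/

theorem gaussianReal_eq_map_stdNormal (m s : ℝ) :
    gaussianReal m (s ^ 2).toNNReal = (gaussianReal 0 1).map (fun x => m + s * x) := by
  have h : (fun x : ℝ => m + s * x) = (fun x => m + x) ∘ (fun x => s * x) := rfl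
  rw [h, ← Measure.map_map (by fun_prop) (by fun_prop), gaussianReal_map_const_mul,
    gaussianReal_map_const_add]
  congr 1
  · simp
  · ext; simp [Real.coe_toNNReal _ (sq_nonneg s)]

/-- The law is written as that of `m - s ξ` with `ξ` standard normal, so that the event is a lower
half-line for `ξ`. -/
theorem gaussianReal_real_Ici_zero {s : ℝ} (hs : 0 < s) (m : ℝ) :
    (gaussianReal m (s ^ 2).toNNReal).real (Set.Ici 0) = stdNormalCDF (m / s) := by
  have h : gaussianReal m (s ^ 2).toNNReal = (gaussianReal 0 1).map (fun x => m + (-s) * x) := by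
    rw [← gaussianReal_eq_map_stdNormal, neg_sq]
  rw [h, map_measureReal_apply (by fun_prop) measurableSet_Ici, stdNormalCDF, cdf_eq_real]
  congr 1
  ext x
  simp only [Set.mem_preimage, Set.mem_Ici, Set.mem_Iic, le_div_iff₀ hs]
  constructor <;> intro h <;> linarith

theorem gaussianReal_real_Iio_zero {s : ℝ} (hs : 0 < s) (m : ℝ) :
    (gaussianReal m (s ^ 2).toNNReal).real (Set.Iio 0) = stdNormalCDF (-m / s) := by
  have : NullSingletonClass (gaussianReal 0 1) := nullSingletonClass_gaussianReal one_ne_zero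
  rw [gaussianReal_eq_map_stdNormal, map_measureReal_apply (by fun_prop) measurableSet_Iio,
    stdNormalCDF, cdf_eq_real, ← measureReal_congr (Iio_ae_eq_Iic (a := -m / s))]
  congr 1
  ext x
  simp only [Set.mem_preimage, Set.mem_Iio, lt_div_iff₀ hs]
  constructor <;> intro h <;> linarith

/-- Exponential tilting shifts the mean of a normal density by its variance. -/
theorem gaussianPDFReal_mul_exp (m : ℝ) {v : NNReal} (hv : v ≠ 0) (z : ℝ) :
    gaussianPDFReal m v z * Real.exp z =
      Real.exp (m + v / 2) * gaussianPDFReal (m + v) v z := by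
  have hv' : (v : ℝ) ≠ 0 := by exact_mod_cast hv
  simp only [gaussianPDFReal]
  rw [mul_assoc, ← Real.exp_add, mul_left_comm, ← Real.exp_add]
  congr 2
  field_simp
  ring

/-- The integral splits at `0`: the integrand is `1` above, and below it is `exp`, which tilting
turns into a multiple of the density of `N(m + s², s²)`. -/
theorem integral_min_one_exp_gaussianReal (m : ℝ) {s : ℝ} (hs : 0 < s) :
    ∫ z, min 1 (Real.exp z) ∂(gaussianReal m (s ^ 2).toNNReal) =
      stdNormalCDF (m / s) + Real.exp (m + s ^ 2 / 2) * stdNormalCDF (-s - m / s) := by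
  set v := (s ^ 2).toNNReal with hv
  have hvs : (v : ℝ) = s ^ 2 := Real.coe_toNNReal _ (sq_nonneg s)
  have hv0 : v ≠ 0 := by
    intro h; rw [h] at hvs; exact (pow_pos hs 2).ne (by simpa using hvs)
  have hint : Integrable (fun z => min 1 (Real.exp z)) (gaussianReal m v) := by
    refine (integrable_const (1 : ℝ)).mono' (by fun_prop) (.of_forall fun z => ?_)
    rw [Real.norm_eq_abs, abs_of_nonneg (by positivity)]
    exact min_le_left _ _
  rw [← integral_add_compl (measurableSet_Ici (a := (0 : ℝ))) hint, Set.compl_Ici]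
  congr 1
  · rw [setIntegral_congr_fun (g := fun _ => (1 : ℝ)) measurableSet_Ici fun z hz =>
      min_eq_left (Real.one_le_exp hz)]
    rw [setIntegral_const, smul_eq_mul, mul_one, hv, gaussianReal_real_Ici_zero hs]
  · rw [setIntegral_congr_fun (g := fun z => Real.exp z) measurableSet_Iio fun z hz =>
      min_eq_right (Real.exp_le_one_iff.2 (le_of_lt hz))]
    have hm : -s - m / s = -(m + s ^ 2) / s := by field_simp; ring
    rw [hm, ← gaussianReal_real_Iio_zero hs, ← hv, ← integral_indicator measurableSet_Iio,
      ← integral_indicator_one measurableSet_Iio,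
      integral_gaussianReal_eq_integral_smul hv0, integral_gaussianReal_eq_integral_smul hv0,
      ← integral_const_mul]
    refine integral_congr_ae (.of_forall fun z => ?_)
    have h := gaussianPDFReal_mul_exp m hv0 z
    rw [hvs] at h
    by_cases hz : z ∈ Set.Iio (0 : ℝ)
    · simp [hz, h]
    · simp [hz]

theorem tendsto_integral_min_one_exp {Ω : ℕ → Type*} [∀ d, MeasurableSpace (Ω d)]
    {P : ∀ d, Measure (Ω d)} [∀ d, IsProbabilityMeasure (P d)] {Z : ∀ d, Ω d → ℝ}
    {ν : Measure ℝ} [IsProbabilityMeasure ν]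
    (h : TendstoInDistribution Z atTop (id : ℝ → ℝ) P ν) :
    Tendsto (fun d => ∫ ω, min 1 (Real.exp (Z d ω)) ∂(P d)) atTop
      (𝓝 (∫ z, min 1 (Real.exp z) ∂ν)) := by
  let f : BoundedContinuousFunction ℝ ℝ := BoundedContinuousFunction.ofNormedAddCommGroup
    (fun z => min 1 (Real.exp z)) (by fun_prop) 1 fun z => by
      rw [Real.norm_eq_abs, abs_of_nonneg (by positivity)]
      exact min_le_left _ _
  have hf : ∀ z, f z = min 1 (Real.exp z) := fun z => rfl
  have := ProbabilityMeasure.tendsto_iff_forall_integral_tendsto.1 h.tendsto f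
  simp only [ProbabilityMeasure.coe_mk, Measure.map_id, hf] at this
  refine this.congr fun d => ?_
  rw [integral_map (h.forall_aemeasurable d) (by fun_prop)]

/-! ### Matrices diagonalized by a fixed orthogonal matrix -/

/-- `Q diag(v) Qᵀ`, the matrix with eigenvalue `v i` on the `i`-th column of `Q`
(for orthogonal `Q`). -/
def conjDiag {d : ℕ} (Q : Matrix (Fin d) (Fin d) ℝ) (v : Fin d → ℝ) : Matrix (Fin d) (Fin d) ℝ :=
  Q * Matrix.diagonal v * Qᵀ

section ConjDiag

variable {d : ℕ} {Q : Matrix (Fin d) (Fin d) ℝ}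

theorem transpose_mul_self_of_orthogonal (hQ : Q ∈ Matrix.orthogonalGroup (Fin d) ℝ) :
    Qᵀ * Q = 1 := by
  simpa [Matrix.star_eq_conjTranspose] using (Matrix.mem_orthogonalGroup_iff' (Fin d) ℝ).1 hQ

theorem mul_transpose_self_of_orthogonal (hQ : Q ∈ Matrix.orthogonalGroup (Fin d) ℝ) :
    Q * Qᵀ = 1 := by
  simpa [Matrix.star_eq_conjTranspose] using (Matrix.mem_orthogonalGroup_iff (Fin d) ℝ).1 hQ

theorem conjDiag_transpose (v : Fin d → ℝ) : (conjDiag Q v)ᵀ = conjDiag Q v := by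
  simp [conjDiag, Matrix.mul_assoc]

theorem conjDiag_sub (v w : Fin d → ℝ) : conjDiag Q v - conjDiag Q w = conjDiag Q (v - w) := by
  rw [conjDiag, conjDiag, conjDiag, ← sub_mul, ← mul_sub, Matrix.diagonal_sub]
  rfl

theorem conjDiag_add (v w : Fin d → ℝ) : conjDiag Q v + conjDiag Q w = conjDiag Q (v + w) := by
  rw [conjDiag, conjDiag, conjDiag, ← add_mul, ← mul_add, Matrix.diagonal_add]
  rfl

theorem conjDiag_mul (hQ : Q ∈ Matrix.orthogonalGroup (Fin d) ℝ) (v w : Fin d → ℝ) :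
    conjDiag Q v * conjDiag Q w = conjDiag Q (v * w) := by
  calc conjDiag Q v * conjDiag Q w
      = Q * Matrix.diagonal v * (Qᵀ * Q) * Matrix.diagonal w * Qᵀ := by
        simp only [conjDiag, Matrix.mul_assoc]
    _ = conjDiag Q (v * w) := by
        rw [transpose_mul_self_of_orthogonal hQ, mul_one, Matrix.mul_assoc Q,
          Matrix.diagonal_mul_diagonal]
        rfl

theorem conjDiag_inv (hQ : Q ∈ Matrix.orthogonalGroup (Fin d) ℝ) {v : Fin d → ℝ}
    (hv : ∀ i, v i ≠ 0) : (conjDiag Q v)⁻¹ = conjDiag Q v⁻¹ := by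
  refine Matrix.inv_eq_right_inv ?_
  have h1 : v * v⁻¹ = fun _ => 1 := funext fun i => mul_inv_cancel₀ (hv i)
  rw [conjDiag_mul hQ, h1, conjDiag, Matrix.diagonal_one, mul_one,
    mul_transpose_self_of_orthogonal hQ]

theorem det_conjDiag (hQ : Q ∈ Matrix.orthogonalGroup (Fin d) ℝ) (v : Fin d → ℝ) :
    (conjDiag Q v).det = ∏ i, v i := by
  rw [conjDiag, Matrix.mul_assoc, Matrix.det_mul_comm, Matrix.mul_assoc,
    transpose_mul_self_of_orthogonal hQ, mul_one, Matrix.det_diagonal]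

theorem pos_of_posDef_conjDiag (hQ : Q ∈ Matrix.orthogonalGroup (Fin d) ℝ) {v : Fin d → ℝ}
    (h : (conjDiag Q v).PosDef) (i : Fin d) : 0 < v i := by
  have hU : IsUnit Q := IsUnit.of_mul_eq_one _ (mul_transpose_self_of_orthogonal hQ)
  have h' : (Q * Matrix.diagonal v * star Q).PosDef := by
    rwa [Matrix.star_eq_conjTranspose, Matrix.conjTranspose_eq_transpose_of_trivial]
  exact Matrix.posDef_diagonal_iff.1 ((Matrix.IsUnit.posDef_star_right_conjugate_iff hU).1 h') i

theorem sqrt_conjDiag (hQ : Q ∈ Matrix.orthogonalGroup (Fin d) ℝ) {v : Fin d → ℝ}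
    (hv : ∀ i, 0 ≤ v i) : CFC.sqrt (conjDiag Q v) = conjDiag Q fun i => Real.sqrt (v i) := by
  refine CFC.sqrt_unique ?_ ?_
  · rw [conjDiag_mul hQ]
    congr 1
    exact funext fun i => Real.mul_self_sqrt (hv i)
  · rw [Matrix.nonneg_iff_posSemidef, conjDiag, ← Matrix.conjTranspose_eq_transpose_of_trivial]
    exact (Matrix.posSemidef_diagonal_iff.2 fun i => Real.sqrt_nonneg _).mul_mul_conjTranspose_same Q

theorem eigAlong_conjDiag (hQ : Q ∈ Matrix.orthogonalGroup (Fin d) ℝ) (v : Fin d → ℝ)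
    (i : Fin d) : eigAlong Q (conjDiag Q v) i = v i := by
  have h : Qᵀ * conjDiag Q v * Q = Matrix.diagonal v := by
    calc Qᵀ * conjDiag Q v * Q = (Qᵀ * Q) * Matrix.diagonal v * (Qᵀ * Q) := by
          simp only [conjDiag, Matrix.mul_assoc]
      _ = _ := by rw [transpose_mul_self_of_orthogonal hQ, mul_one, one_mul]
  simp [eigAlong, h]

theorem act_mul (B C : Matrix (Fin d) (Fin d) ℝ) (x : E d) : act (B * C) x = act B (act C x) := by
  simp [act]

theorem coordAlong_add (x y : E d) (i : Fin d) :
    coordAlong Q (x + y) i = coordAlong Q x i + coordAlong Q y i := by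
  simp [coordAlong, act]

theorem coordAlong_sub (x y : E d) (i : Fin d) :
    coordAlong Q (x - y) i = coordAlong Q x i - coordAlong Q y i := by
  simp [coordAlong, act]

theorem coordAlong_act_conjDiag (hQ : Q ∈ Matrix.orthogonalGroup (Fin d) ℝ) (v : Fin d → ℝ)
    (x : E d) (i : Fin d) : coordAlong Q (act (conjDiag Q v) x) i = v i * coordAlong Q x i := by
  have h : Qᵀ * conjDiag Q v = Matrix.diagonal v * Qᵀ := by
    rw [conjDiag, ← Matrix.mul_assoc, ← Matrix.mul_assoc, transpose_mul_self_of_orthogonal hQ,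
      one_mul]
  rw [coordAlong, ← act_mul, h, act_mul, coordAlong]
  simp [act, Matrix.mulVec_diagonal]

theorem inner_act_conjDiag (v : Fin d → ℝ) (x : E d) :
    inner ℝ x (act (conjDiag Q v) x) = ∑ i, v i * coordAlong Q x i ^ 2 := by
  rw [act, Matrix.inner_toEuclideanCLM, conjDiag, ← Matrix.mulVec_mulVec, ← Matrix.mulVec_mulVec,
    Matrix.dotProduct_mulVec, ← Matrix.mulVec_transpose]
  simp only [dotProduct, Matrix.mulVec_diagonal, coordAlong, act, Matrix.ofLp_toEuclideanCLM]
  exact Finset.sum_congr rfl fun i _ => by ring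

/-- In the eigenbasis of its covariance a Gaussian density factorizes. -/
theorem exists_gaussianDensity_conjDiag (hQ : Q ∈ Matrix.orthogonalGroup (Fin d) ℝ)
    {s : Fin d → ℝ} (hs : ∀ i, 0 < s i) :
    ∃ K : ℝ, 0 < K ∧ ∀ m x : E d, gaussianDensity m (conjDiag Q s) x =
      K * Real.exp (-(1 / 2) * ∑ i, (s i)⁻¹ * (coordAlong Q x i - coordAlong Q m i) ^ 2) := by
  refine ⟨(Real.sqrt ((2 * Real.pi) ^ d * (conjDiag Q s).det))⁻¹, ?_, fun m x => ?_⟩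
  · have : 0 < (conjDiag Q s).det := by
      rw [det_conjDiag hQ]
      exact Finset.prod_pos fun i _ => hs i
    positivity
  · rw [gaussianDensity, conjDiag_inv hQ fun i => (hs i).ne', inner_act_conjDiag]
    simp only [coordAlong_sub, Pi.inv_apply]

/-! ### The laws of the coordinates in the eigenbasis -/

theorem measurable_coordAlong (Q : Matrix (Fin d) (Fin d) ℝ) :
    Measurable fun x : E d => fun i => coordAlong Q x i := by
  have : Continuous fun x : E d => act Qᵀ x := (Matrix.toEuclideanCLM (𝕜 := ℝ) Qᵀ).continuous
  refine measurable_pi_lambda _ fun i => ?_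
  unfold coordAlong
  fun_prop

theorem hasLaw_coordAlong_stdGaussian (hQ : Q ∈ Matrix.orthogonalGroup (Fin d) ℝ) :
    HasLaw (fun x : E d => fun i => coordAlong Q x i) (Measure.pi fun _ => gaussianReal 0 1)
      (stdGaussian (E d)) := by
  -- `Qᵀ` preserves norms, hence the characteristic function `exp (-‖t‖² / 2)`
  have hrot : (stdGaussian (E d)).map (Matrix.toEuclideanCLM (𝕜 := ℝ) Qᵀ) = stdGaussian (E d) := by
    refine Measure.ext_of_charFun (funext fun t => ?_)
    have hadj : ContinuousLinearMap.adjoint (Matrix.toEuclideanCLM (𝕜 := ℝ) Qᵀ)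
        = Matrix.toEuclideanCLM (𝕜 := ℝ) Q := by
      rw [← ContinuousLinearMap.star_eq_adjoint, ← map_star, Matrix.star_eq_conjTranspose,
        Matrix.conjTranspose_eq_transpose_of_trivial, Matrix.transpose_transpose]
    have hn : ‖Matrix.toEuclideanCLM (𝕜 := ℝ) Q t‖ ^ 2 = ‖t‖ ^ 2 := by
      rw [← real_inner_self_eq_norm_sq, ← real_inner_self_eq_norm_sq, ← hadj,
        ContinuousLinearMap.adjoint_inner_left, hadj, ← ContinuousLinearMap.comp_apply,
        ← ContinuousLinearMap.mul_def, ← map_mul, transpose_mul_self_of_orthogonal hQ, map_one]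
      rfl
    rw [charFun_apply, integral_map (by fun_prop) (by fun_prop)]
    simp only [← ContinuousLinearMap.adjoint_inner_right, hadj]
    rw [← charFun_apply, charFun_stdGaussian, charFun_stdGaussian, ← Complex.ofReal_pow, hn,
      Complex.ofReal_pow]
  have hof : (stdGaussian (E d)).map (WithLp.ofLp) = Measure.pi fun _ : Fin d => gaussianReal 0 1 := by
    rw [← map_pi_eq_stdGaussian, Measure.map_map (by fun_prop) (by fun_prop)]
    exact Measure.map_id
  refine ⟨(measurable_coordAlong Q).aemeasurable, ?_⟩
  have h : (fun x : E d => fun i => coordAlong Q x i)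
      = WithLp.ofLp ∘ (Matrix.toEuclideanCLM (𝕜 := ℝ) Qᵀ) := rfl
  rw [h, ← Measure.map_map (by fun_prop) (by fun_prop), hrot, hof]

/-- Subtracting the mean, rotating by `Qᵀ` and rescaling turns `N(m, A⁻¹)` with
`A = Q diag(lam²) Qᵀ` into a vector of independent standard normals. -/
theorem hasLaw_whitened_multivariateGaussian (hQ : Q ∈ Matrix.orthogonalGroup (Fin d) ℝ)
    {lam : Fin d → ℝ} (hlam : ∀ i, 0 < lam i) (m : E d) :
    HasLaw (fun x : E d => fun i => lam i * (coordAlong Q x i - coordAlong Q m i))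
      (Measure.pi fun _ => gaussianReal 0 1)
      (multivariateGaussian m (conjDiag Q fun i => lam i ^ 2)⁻¹) := by
  have hmeas : Measurable fun x : E d => fun i => lam i * (coordAlong Q x i - coordAlong Q m i) :=
    measurable_pi_lambda _ fun i =>
      (((measurable_pi_apply i).comp (measurable_coordAlong Q)).sub_const _).const_mul _
  refine ⟨hmeas.aemeasurable, ?_⟩
  have hsqrt : CFC.sqrt (conjDiag Q fun i => lam i ^ 2)⁻¹ = conjDiag Q lam⁻¹ := by
    rw [conjDiag_inv hQ fun i => (pow_pos (hlam i) 2).ne',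
      sqrt_conjDiag hQ fun i => by simp only [Pi.inv_apply]; positivity]
    congr 1
    funext i
    simp [Real.sqrt_sq (hlam i).le]
  rw [multivariateGaussian, hsqrt, Measure.map_map hmeas (by fun_prop),
    ← (hasLaw_coordAlong_stdGaussian hQ).map_eq]
  congr 1
  funext x i
  have h := coordAlong_act_conjDiag hQ lam⁻¹ x i
  rw [act] at h
  simp only [Function.comp_apply, coordAlong_add, h, add_sub_cancel_left, Pi.inv_apply]
  rw [mul_inv_cancel_left₀ (hlam i).ne']

theorem hasLaw_pairs {Ω : Type*} [MeasurableSpace Ω] {P : Measure Ω} [IsProbabilityMeasure P]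
    {u v : Ω → Fin d → ℝ} (hu : HasLaw u (Measure.pi fun _ => gaussianReal 0 1) P)
    (hv : HasLaw v (Measure.pi fun _ => gaussianReal 0 1) P) (h : IndepFun u v P) :
    HasLaw (fun ω i => (u ω i, v ω i)) (Measure.pi fun _ : Fin d => stdNormalPair) P := by
  have hjoint : HasLaw (fun ω => (u ω, v ω))
      ((Measure.pi fun _ : Fin d => gaussianReal 0 1).prod
        (Measure.pi fun _ : Fin d => gaussianReal 0 1)) P := by
    refine ⟨hu.aemeasurable.prodMk hv.aemeasurable, ?_⟩
    rw [(indepFun_iff_map_prod_eq_prod_map_map hu.aemeasurable hv.aemeasurable).1 h, hu.map_eq,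
      hv.map_eq]
  exact ((measurePreserving_arrowProdEquivProdArrow ℝ ℝ (Fin d) (fun _ => gaussianReal 0 1)
    fun _ => gaussianReal 0 1).symm).hasLaw.comp hjoint

end ConjDiag

/-! ### The log acceptance ratio as a sum of quadratic polynomials -/

/-- One coordinate of the log acceptance ratio in the eigenbasis. Here `x` and `y` are the
coordinates of the state and the proposal, `β` and `m` those of the proposal shift and the target
mean, and `p`, `n` the eigenvalues of the two splitting matrices. -/
theorem coordinate_logRatio_eq {lam p n m β x ν : ℝ} (hlam : 0 < lam) (hsub : 0 < p - n)
    (hadd : 0 < p + n) :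
    let c := p - n
    let G := p⁻¹ * n
    let S := c⁻¹ - G * c⁻¹ * G
    let y := G * x + p⁻¹ * β + Real.sqrt S * ν
    let T := coefT lam c G (m - c⁻¹ * β);
    -(1 / 2) * (lam ^ 2 * (y - m) ^ 2) - 1 / 2 * (S⁻¹ * (x - (G * y + p⁻¹ * β)) ^ 2)
        + 1 / 2 * (lam ^ 2 * (x - m) ^ 2) + 1 / 2 * (S⁻¹ * (y - (G * x + p⁻¹ * β)) ^ 2)
      = meanOf T + centredQuad T (lam * (x - m), ν) := by
  intro c G S y T
  have hp : 0 < p := by linarith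
  have hc : 0 < c := hsub
  have hg : 0 < 1 - G ^ 2 := by
    have : 1 - G ^ 2 = (p - n) * (p + n) / p ^ 2 := by simp only [G]; field_simp; ring
    rw [this]; positivity
  have hS : S = (1 - G ^ 2) / c := by simp only [S]; field_simp
  have hS0 : 0 < S := by rw [hS]; positivity
  obtain ⟨mt, hmt⟩ : ∃ mt, mt = c⁻¹ * β := ⟨_, rfl⟩
  have hβ : p⁻¹ * β = (1 - G) * mt := by
    have : β = c * mt := by rw [hmt]; field_simp
    rw [this]; simp only [G, c]; field_simp
  set w := Real.sqrt S with hw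
  have hw2 : w ^ 2 = S := Real.sq_sqrt hS0.le
  have hroot : Real.sqrt (1 - G ^ 2) * Real.sqrt (1 + (lam ^ 2 - c) / c) = lam * w := by
    rw [← Real.sqrt_mul hg.le, ← Real.sqrt_sq hlam.le, hw, ← Real.sqrt_mul (sq_nonneg lam), hS,
      Real.sqrt_sq hlam.le]
    congr 1; field_simp; ring
  -- the two transition terms combine, since `(X - G Y)² - (Y - G X)² = (1 - G²) (X² - Y²)`
  have htrans : 1 / 2 * (S⁻¹ * (y - (G * x + p⁻¹ * β)) ^ 2)
      - 1 / 2 * (S⁻¹ * (x - (G * y + p⁻¹ * β)) ^ 2)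
      = 1 / 2 * c * ((y - mt) ^ 2 - (x - mt) ^ 2) := by
    have hSc : S⁻¹ * (1 - G ^ 2) = c := by rw [hS]; field_simp
    rw [hβ]
    linear_combination (1 / 2) * ((y - mt) ^ 2 - (x - mt) ^ 2) * hSc
  have hy : y = G * x + (1 - G) * mt + w * ν := by simp only [y]; rw [hβ]
  -- with `r` in place of `c`, and `w = √S` the only root, both sides are polynomials
  obtain ⟨r, hr⟩ : ∃ r, r = (lam ^ 2 - c) / lam ^ 2 := ⟨_, rfl⟩
  have hcr : c = lam ^ 2 * (1 - r) := by rw [hr]; field_simp; ring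
  have hT4 : r * (1 - G ^ 2) * (1 + (lam ^ 2 - c) / c) = r * lam ^ 2 * w ^ 2 := by
    rw [hw2, hS]; field_simp; ring
  have hTv : T = ![(m - mt) ^ 2 * lam ^ 2 * (1 / 2 * r * (1 - G ^ 2) - (1 - G)),
      (m - mt) * lam * (r * (1 - G ^ 2) - (1 - G)),
      (m - mt) * lam * (lam * w) * (1 - r * G),
      1 / 2 * r * (1 - G ^ 2), -(1 / 2) * (r * lam ^ 2 * w ^ 2), -r * G * (lam * w)] := by
    rw [← hT4, ← hroot, hr, hmt]
    simp only [T, coefT, mul_assoc]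
  rw [centredQuad_eq, meanOf, hTv]
  have e0 : -(1 / 2) * (lam ^ 2 * (y - m) ^ 2) - 1 / 2 * (S⁻¹ * (x - (G * y + p⁻¹ * β)) ^ 2)
      + 1 / 2 * (lam ^ 2 * (x - m) ^ 2) + 1 / 2 * (S⁻¹ * (y - (G * x + p⁻¹ * β)) ^ 2)
      = -(1 / 2) * (lam ^ 2 * (y - m) ^ 2) + 1 / 2 * (lam ^ 2 * (x - m) ^ 2)
        + 1 / 2 * c * ((y - mt) ^ 2 - (x - mt) ^ 2) := by linarith
  rw [e0, hy, hcr]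
  simp
  ring

theorem log_ratio_of_exp {K K' a b a' b' : ℝ} (hK : 0 < K) (hK' : 0 < K') :
    Real.log ((K * Real.exp a * (K' * Real.exp b)) / (K * Real.exp a' * (K' * Real.exp b'))) =
      a + b - a' - b' := by
  have h : (K * Real.exp a * (K' * Real.exp b)) / (K * Real.exp a' * (K' * Real.exp b')) =
      Real.exp (a + b - a' - b') := by
    rw [Real.exp_sub, Real.exp_sub, Real.exp_add]
    field_simp
  rw [h, Real.log_exp]

section Splitting

variable {d : ℕ} {Q : Matrix (Fin d) (Fin d) ℝ} {lam p n : Fin d → ℝ}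

/-- In the eigenbasis the Metropolis-Hastings ratio is positive and its logarithm is a sum of
quadratic polynomials, one for each coordinate, in the whitened state and the noise. -/
theorem mhRatio_pos_and_logRatio_eq (hQ : Q ∈ Matrix.orthogonalGroup (Fin d) ℝ)
    (hlam : ∀ i, 0 < lam i) (hsub : ∀ i, 0 < p i - n i) (hadd : ∀ i, 0 < p i + n i)
    (b β x ξ : E d) :
    let A := conjDiag Q fun i => lam i ^ 2
    let M := conjDiag Q p
    let N := conjDiag Q n
    0 < mhRatio A M N b β x (proposal M N β x ξ) ∧
    logRatio A M N b β x (proposal M N β x ξ) =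
      ∑ i, (meanOf (splitT A M N b β Q lam i) + centredQuad (splitT A M N b β Q lam i)
        (lam i * (coordAlong Q x i - coordAlong Q (act A⁻¹ b) i), coordAlong Q ξ i)) := by
  intro A M N
  have hp : ∀ i, 0 < p i := fun i => by linarith [hsub i, hadd i]
  have hMi : M⁻¹ = conjDiag Q p⁻¹ := conjDiag_inv hQ fun i => (hp i).ne'
  have hG : iterMatrix M N = conjDiag Q (p⁻¹ * n) := by rw [iterMatrix, hMi, conjDiag_mul hQ]
  have hc : M - N = conjDiag Q (p - n) := conjDiag_sub p n
  have hci : (M - N)⁻¹ = conjDiag Q (p - n)⁻¹ := by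
    rw [hc]; exact conjDiag_inv hQ fun i => (hsub i).ne'
  have hcov : proposalCov M N =
      conjDiag Q ((p - n)⁻¹ - p⁻¹ * n * (p - n)⁻¹ * (p⁻¹ * n)) := by
    rw [proposalCov, hG, hci, conjDiag_transpose, conjDiag_mul hQ, conjDiag_mul hQ, conjDiag_sub]
  set S : Fin d → ℝ := (p - n)⁻¹ - p⁻¹ * n * (p - n)⁻¹ * (p⁻¹ * n) with hSdef
  have hS : ∀ i, 0 < S i := by
    intro i
    have h1 := hsub i
    have h2 := hadd i
    have h3 := hp i
    have : S i = (p i + n i) / (p i) ^ 2 := by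
      simp only [hSdef, Pi.sub_apply, Pi.mul_apply, Pi.inv_apply]
      field_simp
      ring
    rw [this]; positivity
  have hAi : A⁻¹ = conjDiag Q (fun i => lam i ^ 2)⁻¹ :=
    conjDiag_inv hQ fun i => (pow_pos (hlam i) 2).ne'
  obtain ⟨K, hK, hπ⟩ := exists_gaussianDensity_conjDiag (s := (fun i => lam i ^ 2)⁻¹) hQ
    fun i => by simp only [Pi.inv_apply]; exact inv_pos.2 (pow_pos (hlam i) 2)
  obtain ⟨K', hK', hq⟩ := exists_gaussianDensity_conjDiag hQ hS
  have hmean : ∀ z i, coordAlong Q (proposalMean M N β z) i =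
      (p i)⁻¹ * n i * coordAlong Q z i + (p i)⁻¹ * coordAlong Q β i := by
    intro z i
    rw [proposalMean, coordAlong_add, hG, hMi, coordAlong_act_conjDiag hQ,
      coordAlong_act_conjDiag hQ]
    rfl
  have hy : ∀ i, coordAlong Q (proposal M N β x ξ) i =
      (p i)⁻¹ * n i * coordAlong Q x i + (p i)⁻¹ * coordAlong Q β i
        + Real.sqrt (S i) * coordAlong Q ξ i := by
    intro i
    rw [proposal, coordAlong_add, hmean, hcov, sqrt_conjDiag hQ fun i => (hS i).le,
      coordAlong_act_conjDiag hQ]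
  constructor
  · simp only [mhRatio, targetDensity, proposalDensity, hcov]
    rw [hAi]
    simp only [hπ, hq]
    positivity
  · simp only [logRatio, mhRatio, targetDensity, proposalDensity, hcov]
    rw [hAi]
    simp only [hπ, hq]
    rw [log_ratio_of_exp hK hK', ← hAi]
    simp only [Finset.mul_sum, ← Finset.sum_add_distrib, ← Finset.sum_sub_distrib]
    refine Finset.sum_congr rfl fun i _ => ?_
    have key := coordinate_logRatio_eq (m := coordAlong Q (act A⁻¹ b) i)
      (β := coordAlong Q β i) (x := coordAlong Q x i) (ν := coordAlong Q ξ i)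
      (hlam i) (hsub i) (hadd i)
    have hT : splitT A M N b β Q lam i = coefT (lam i) (p i - n i) ((p i)⁻¹ * n i)
        (coordAlong Q (act A⁻¹ b) i - (p i - n i)⁻¹ * coordAlong Q β i) := by
      rw [splitT, hci, hc, hG, eigAlong_conjDiag hQ, eigAlong_conjDiag hQ,
        coordAlong_act_conjDiag hQ]
      rfl
    rw [hT]
    simp only at key
    rw [← key]
    have hSi : S i = (p i - n i)⁻¹ - (p i)⁻¹ * n i * (p i - n i)⁻¹ * ((p i)⁻¹ * n i) := rfl
    simp only [hmean, hy, hSi, Pi.inv_apply, inv_inv]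
    ring

end Splitting

end SplittingMH

/-! ### Convergence of the log ratio and of the acceptance rate -/

open SplittingMH in
theorem mainTheorem1
    (A M N Q : (d : ℕ) → Matrix (Fin d) (Fin d) ℝ)
    (b β : (d : ℕ) → EuclideanSpace ℝ (Fin d))
    (lam : (d : ℕ) → Fin d → ℝ)
    -- spectral decomposition of the positive definite precision matrix
    (hQ : ∀ d, Q d ∈ Matrix.orthogonalGroup (Fin d) ℝ)
    (hlam : ∀ d i, 0 < lam d i)
    (hA : ∀ d, A d = Q d * Matrix.diagonal (fun i => lam d i ^ 2) * (Q d)ᵀ)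
    -- the splitting matrices are functions of the precision matrix
    (hM : ∀ d, IsFunctionOf (M d) (A d))
    (hN : ∀ d, IsFunctionOf (N d) (A d))
    -- the proposal target precision and the noise covariance are positive definite
    (hcalA : ∀ d, (M d - N d).PosDef)
    (hnoise : ∀ d, ((M d)ᵀ + N d).PosDef)
    -- the state in equilibrium, and the independent noise driving the proposal
    {Ω : ℕ → Type*} [∀ d, MeasurableSpace (Ω d)] (P : (d : ℕ) → Measure (Ω d))
    [∀ d, IsProbabilityMeasure (P d)]
    (x ξ : (d : ℕ) → Ω d → EuclideanSpace ℝ (Fin d))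
    (hx : ∀ d, HasLaw (x d) (multivariateGaussian (act (A d)⁻¹ (b d)) (A d)⁻¹) (P d))
    (hξ : ∀ d, HasLaw (ξ d) (stdGaussian (EuclideanSpace ℝ (Fin d))) (P d))
    (hindep : ∀ d, IndepFun (x d) (ξ d) (P d))
    -- Lyapunov-type condition for `j = 1, …, 5` (where `0 / 0 = 0`)
    (δ : ℝ) (hδ : 0 < δ)
    (hT : ∀ j : Fin 6, j ≠ 0 → Tendsto (fun d : ℕ =>
      (∑ i, |splitT (A d) (M d) (N d) (b d) (β d) (Q d) (lam d) i j| ^ (2 + δ)) /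
        (∑ i, |splitT (A d) (M d) (N d) (b d) (β d) (Q d) (lam d) i j| ^ 2) ^ (1 + δ / 2))
      atTop (𝓝 0))
    -- the limits `μ` and `σ²`
    (μ σ : ℝ) (hσ : 0 ≤ σ)
    (hμlim : Tendsto (fun d : ℕ =>
      ∑ i, meanOf (splitT (A d) (M d) (N d) (b d) (β d) (Q d) (lam d) i)) atTop (𝓝 μ))
    (hσlim : Tendsto (fun d : ℕ =>
      ∑ i, varOf (splitT (A d) (M d) (N d) (b d) (β d) (Q d) (lam d) i)) atTop (𝓝 (σ ^ 2))) :
    TendstoInDistribution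
      (fun d ω => logRatio (A d) (M d) (N d) (b d) (β d) (x d ω)
        (proposal (M d) (N d) (β d) (x d ω) (ξ d ω)))
      atTop (id : ℝ → ℝ) P (gaussianReal μ (σ ^ 2).toNNReal) ∧
    (0 < σ → Tendsto (fun d : ℕ =>
      ∫ ω, acceptProb (A d) (M d) (N d) (b d) (β d) (x d ω)
        (proposal (M d) (N d) (β d) (x d ω) (ξ d ω)) ∂(P d)) atTop
      (𝓝 (stdNormalCDF (μ / σ) +
        Real.exp (μ + σ ^ 2 / 2) * stdNormalCDF (-σ - μ / σ)))) := by
  classical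
  choose f hf using hM
  choose h hh using hN
  obtain ⟨p, hp⟩ : ∃ p : ∀ d, Fin d → ℝ, ∀ d, M d = conjDiag (Q d) (p d) :=
    ⟨fun d i => f d (lam d i ^ 2), fun d => by
      rw [hf d, cfc_eq_conj_diagonal (hQ d) (hA d)]; rfl⟩
  obtain ⟨n, hn⟩ : ∃ n : ∀ d, Fin d → ℝ, ∀ d, N d = conjDiag (Q d) (n d) :=
    ⟨fun d i => h d (lam d i ^ 2), fun d => by
      rw [hh d, cfc_eq_conj_diagonal (hQ d) (hA d)]; rfl⟩
  have hsub : ∀ d i, 0 < p d i - n d i := fun d i => by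
    have hpos := hcalA d
    rw [hp, hn, conjDiag_sub] at hpos
    exact pos_of_posDef_conjDiag (hQ d) hpos i
  have hadd : ∀ d i, 0 < p d i + n d i := fun d i => by
    have hpos := hnoise d
    rw [hp, hn, conjDiag_transpose, conjDiag_add] at hpos
    exact pos_of_posDef_conjDiag (hQ d) hpos i
  have hA' : ∀ d, A d = conjDiag (Q d) fun i => lam d i ^ 2 := hA
  -- the whitened state and the rotated noise are independent standard Gaussian vectors
  have hlaw : ∀ d, HasLaw
      (fun ω i => (lam d i * (coordAlong (Q d) (x d ω) i - coordAlong (Q d) (act (A d)⁻¹ (b d)) i),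
        coordAlong (Q d) (ξ d ω) i))
      (Measure.pi fun _ : Fin d => stdNormalPair) (P d) := by
    intro d
    have hx' := hx d
    rw [congrArg (fun B => multivariateGaussian (act (A d)⁻¹ (b d)) B⁻¹) (hA' d)] at hx'
    have hmeas : Measurable fun z : E d => fun i =>
        lam d i * (coordAlong (Q d) z i - coordAlong (Q d) (act (A d)⁻¹ (b d)) i) :=
      measurable_pi_lambda _ fun i =>
        (((measurable_pi_apply i).comp (measurable_coordAlong (Q d))).sub_const _).const_mul _
    exact hasLaw_pairs
      ((hasLaw_whitened_multivariateGaussian (hQ d) (hlam d) _).comp hx')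
      ((hasLaw_coordAlong_stdGaussian (hQ d)).comp (hξ d))
      ((hindep d).comp hmeas (measurable_coordAlong (Q d)))
  have hratio : ∀ d ω,
      0 < mhRatio (A d) (M d) (N d) (b d) (β d) (x d ω)
        (proposal (M d) (N d) (β d) (x d ω) (ξ d ω)) ∧ _ := fun d ω => by
    have key := mhRatio_pos_and_logRatio_eq (hQ d) (hlam d) (hsub d) (hadd d) (b d) (β d)
      (x d ω) (ξ d ω)
    simp only [← hp, ← hn, ← hA'] at key
    exact key
  have hconv : TendstoInDistribution
      (fun d ω => logRatio (A d) (M d) (N d) (b d) (β d) (x d ω)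
        (proposal (M d) (N d) (β d) (x d ω) (ξ d ω)))
      atTop (id : ℝ → ℝ) P (gaussianReal μ (σ ^ 2).toNNReal) := by
    have hclt := tendstoInDistribution_sum_centredQuad hlaw hδ hT hμlim hσlim
    exact hclt.congr (fun d => .of_forall fun ω => (hratio d ω).2.symm) (.of_forall fun _ => rfl)
  refine ⟨hconv, fun hσ0 => ?_⟩
  rw [← integral_min_one_exp_gaussianReal μ hσ0]
  refine (tendsto_integral_min_one_exp hconv).congr fun d => ?_
  refine integral_congr_ae (.of_forall fun ω => ?_)
  simp only [acceptProb, logRatio]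
  rw [Real.exp_log (hratio d ω).1]
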